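/- **Theorem 2.2.** Let $x$ be a real number with $|x|<1$ and let $\mathbf{k}=(k_1,\ldots,k_r)$ be an index, i.e. a finite (possibly empty) sequence of positive integers. For positive integers $N$ and real $0<t<1$ put $$\zeta_N^{(x)}(\mathbf{k})=\sum_{0<m_1<\cdots<m_r<N}\frac1{(m_1+x)^{k_1}\cdots(m_r+x)^{k_r}},\qquad \mathrm{Li}_{\mathbf{k}}^{(x)}(t)=\sum_{0<m_1<\cdots<m_r}\frac{t^{m_r+x}}{(m_1+x)^{k_1}\cdots(m_r+x)^{k_r}},$$ both understood as $1$ if $r=0$. Let $\psi=\Gamma'/\Gamma$ be the digamma function and $\gamma$ Euler's constant. Then there are unique polynomials $Z_*^{(x)}(\mathbf{k};T)$ and $P^{(x)}(\mathbf{k};T)$ in $\mathbb{R}[T]$ such that, for some integer $p>0$, $$\zeta_N^{(x)}(\mathbf{k})=Z_*^{(x)}\bigl(\mathbf{k};\log N-\psi(1+x)\bigr)+O\bigl(N^{-1}\log^pN\bigr)\quad(N\to\infty)$$ and, for some integer $p>0$, $$\mathrm{Li}_{\mathbf{k}}^{(x)}(t)=P^{(x)}\bigl(\mathbf{k};-\log(1-t)\bigr)+O\bigl((1-t)\log^p(1-t)\bigr)\quad(t\to1^-),$$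 and they satisfy $$P^{(x)}(\mathbf{k};T)=\rho\bigl(Z_*^{(x)}(\mathbf{k};T-\gamma-\psi(1+x))\bigr).$$ Here $\rho:\mathbb{R}[T]\to\mathbb{R}[T]$ is the $\mathbb{R}$-linear map determined by $\rho(e^{Ty})=A(y)e^{Ty}$ in $\mathbb{R}[T][[y]]$, where $\rho$ acts coefficientwise in $y$ and $A(y)\in\mathbb{R}[[y]]$ is the Taylor series at $y=0$ of $e^{\gamma y}\Gamma(1+y)$. -/

import Mathlib

namespace HurwitzMZV

open Polynomial Filter Topology Asymptotics

/-- The digamma function `ψ = Γ'/Γ` of a real variable. -/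
noncomputable def digamma (s : ℝ) : ℝ := deriv Real.Gamma s / Real.Gamma s

open Classical in
/-- `ζ_N^{(x)}(k₁,…,k_r) = ∑_{0 < m₁ < ⋯ < m_r < N} ∏ᵢ (mᵢ + x)^{-kᵢ}`; the value is `1` if `r = 0`. -/
noncomputable def zetaTrunc (x : ℝ) {r : ℕ} (k : Fin r → ℕ+) (N : ℕ) : ℝ :=
  ∑ m ∈ (Fintype.piFinset fun _ : Fin r => Finset.Ioo 0 N).filter StrictMono,
    1 / ∏ i, ((m i : ℝ) + x) ^ (k i : ℕ)

/-- `Li^{(x)}_{k₁,…,k_r}(t) = ∑_{0 < m₁ < ⋯ < m_r} t^{m_r + x} ∏ᵢ (mᵢ + x)^{-kᵢ}`, and `1` if `r = 0`.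
For `|x| < 1` and `0 < t < 1` this is a convergent series of positive terms. -/
noncomputable def hurwitzLi (x : ℝ) : {r : ℕ} → (Fin r → ℕ+) → ℝ → ℝ
  | 0, _, _ => 1
  | r + 1, k, t =>
    ∑' m : {m : Fin (r + 1) → ℕ // StrictMono m ∧ ∀ i, 0 < m i},
      t ^ ((m.1 (Fin.last r) : ℝ) + x) / ∏ i, ((m.1 i : ℝ) + x) ^ (k i : ℕ)

/-- `Z` describes the divergence of `ζ_N^{(x)}(k)`: for some `p > 0`,
`ζ_N^{(x)}(k) = Z(log N - ψ(1+x)) + O(N⁻¹ log^p N)` as `N → ∞`. -/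
def IsSeriesReg (x : ℝ) {r : ℕ} (k : Fin r → ℕ+) (Z : ℝ[X]) : Prop :=
  ∃ p : ℕ, 0 < p ∧
    (fun N : ℕ => zetaTrunc x k N - Z.eval (Real.log N - digamma (1 + x)))
      =O[atTop] fun N : ℕ => (N : ℝ)⁻¹ * Real.log N ^ p

/-- `P` describes the divergence of `Li^{(x)}_k(t)`: for some `p > 0`,
`Li^{(x)}_k(t) = P(-log(1-t)) + O((1-t) log^p(1-t))` as `t → 1` from below. -/
def IsIntegralReg (x : ℝ) {r : ℕ} (k : Fin r → ℕ+) (P : ℝ[X]) : Prop :=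
  ∃ p : ℕ, 0 < p ∧
    (fun t : ℝ => hurwitzLi x k t - P.eval (-Real.log (1 - t)))
      =O[𝓝[<] 1] fun t : ℝ => (1 - t) * Real.log (1 - t) ^ p

/-- The polynomial `Z_*^{(x)}(k; T)` characterized by `IsSeriesReg`. -/
noncomputable def seriesRegPoly (x : ℝ) {r : ℕ} (k : Fin r → ℕ+) : ℝ[X] :=
  Classical.epsilon (IsSeriesReg x k)

/-- The polynomial `P^{(x)}(k; T)` characterized by `IsIntegralReg`. -/
noncomputable def integralRegPoly (x : ℝ) {r : ℕ} (k : Fin r → ℕ+) : ℝ[X] :=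
  Classical.epsilon (IsIntegralReg x k)

/-- The Taylor series at `y = 0` of `A(y) = e^{γ y} Γ(1 + y)`. -/
noncomputable def gammaSeries : PowerSeries ℝ :=
  PowerSeries.mk fun n =>
    iteratedDeriv n
      (fun y : ℝ => Real.exp (Real.eulerMascheroniConstant * y) * Real.Gamma (1 + y)) 0
      / (n.factorial : ℝ)

/-- The series `e^{Ty} = ∑ₙ (Tⁿ / n!) yⁿ` in `ℝ[T]⟦y⟧`. -/
noncomputable def expTy : PowerSeries ℝ[X] :=
  PowerSeries.mk fun n => monomial n ((n.factorial : ℝ)⁻¹)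

/-- The `ℝ`-linear map `ρ` on `ℝ[T]` with `ρ(e^{Ty}) = A(y) e^{Ty}`: the image of `Tⁿ` is `n!` times
the coefficient of `yⁿ` in `A(y) e^{Ty}`. -/
noncomputable def rho : ℝ[X] →ₗ[ℝ] ℝ[X] :=
  (basisMonomials ℝ).constr ℝ fun n =>
    (n.factorial : ℝ) • PowerSeries.coeff n (PowerSeries.map C gammaSeries * expTy)

/-- `rho` is the only linear map that, applied coefficientwise, sends `e^{Ty}` to `A(y) e^{Ty}`. -/
theorem eq_rho_iff (f : ℝ[X] →ₗ[ℝ] ℝ[X]) :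
    f = rho ↔ (PowerSeries.mk fun n => f (PowerSeries.coeff n expTy))
      = PowerSeries.map C gammaSeries * expTy := by
  have key : ∀ (g : ℝ[X] →ₗ[ℝ] ℝ[X]) (n : ℕ),
      g (monomial n 1) = (n.factorial : ℝ) • g (PowerSeries.coeff n expTy) := by
    intro g n
    have h : (n.factorial : ℝ) ≠ 0 := by positivity
    rw [← map_smul, expTy, PowerSeries.coeff_mk, smul_monomial, smul_eq_mul, mul_inv_cancel₀ h]
  have hrho : ∀ n : ℕ, rho (monomial n 1) =
      (n.factorial : ℝ) • PowerSeries.coeff n (PowerSeries.map C gammaSeries * expTy) := by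
    intro n
    have h : monomial n (1 : ℝ) = basisMonomials ℝ n := by rw [coe_basisMonomials]
    rw [rho, h, Module.Basis.constr_basis]
  constructor
  · rintro rfl
    ext1 n
    have h : (n.factorial : ℝ) ≠ 0 := by positivity
    rw [PowerSeries.coeff_mk]
    exact smul_right_injective _ h ((key rho n).symm.trans (hrho n))
  · intro h
    refine (basisMonomials ℝ).ext fun n => ?_
    rw [coe_basisMonomials, hrho, key, ← h, PowerSeries.coeff_mk]

end HurwitzMZV

namespace HurwitzMZV

open Polynomial Filter Topology Asymptotics

/-! One polynomial `W` in `log N` governs both expansions. Splitting off the largest index writes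
the truncated sum as a sum over `M` of a shallower truncated sum divided by `(M + x)^κ`. By
induction the shallower sum is a polynomial in `log M` up to `O(log^p M / M)`. For `κ ≥ 2` the sum
converges. For `κ = 1` it is compared with the telescoping increments of an antiderivative in `log
M`. In both cases the leftover terms are `O(log^p M / M²)`, so they contribute a constant plus an
admissible remainder (`exists_zetaTrunc_asymp`).

For the polylogarithm put `s = -log t`. Since `t^m = e^{-ms}` is the probability that a standard
exponential variable `v` is at least `ms`, Abel summation says that the polylogarithm is `t^x` times
the mean of the truncated sum at `⌊v/s⌋ + 1` (`hurwitzLi_eq_integral`). Replacing that sum by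
`W(log(v/s)) = W(-log s + log v)` costs `O(s log^q s)`. The moment generating function of `γ + log
v` is `e^{γy} Γ(1+y)`, so `ρ` is exactly the averaging over shifts by `γ + log v` (`eval_rho`). The
mean is therefore `ρ(W(T - γ))` at `T = -log s`, and passing from `s` to `1 - t` is harmless.

The digamma value is only a recentring: `Z(T) = W(T + ψ(1+x))`, which yields the relation between
the two polynomials. Uniqueness holds because a nonzero polynomial cannot tend to `0` along an
argument tending to infinity. -/

/-! ### Growth and increments of polynomials -/

theorem exists_eval_taylor_le (R : ℝ[X]) : ∃ (C : ℝ) (p : ℕ), 0 ≤ C ∧ ∀ a d : ℝ, |d| ≤ 1 →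
    |R.eval (a + d) - R.eval a - R.derivative.eval a * d| ≤ C * (1 + |a|) ^ p * d ^ 2 := by
  induction R using Polynomial.induction_on' with
  | add P Q hP hQ =>
    obtain ⟨C, p, hC, h⟩ := hP
    obtain ⟨D, q, hD, h'⟩ := hQ
    refine ⟨C + D, p + q, by positivity, fun a d hd => ?_⟩
    have h1 : (1 : ℝ) ≤ 1 + |a| := by linarith [abs_nonneg a]
    have e : (P + Q).eval (a + d) - (P + Q).eval a - (P + Q).derivative.eval a * d
        = (P.eval (a + d) - P.eval a - P.derivative.eval a * d)
          + (Q.eval (a + d) - Q.eval a - Q.derivative.eval a * d) := by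
      simp; ring
    rw [e]
    refine (abs_add_le _ _).trans ?_
    have hp : (1 + |a|) ^ p ≤ (1 + |a|) ^ (p + q) := pow_le_pow_right₀ h1 (by omega)
    have hq : (1 + |a|) ^ q ≤ (1 + |a|) ^ (p + q) := pow_le_pow_right₀ h1 (by omega)
    calc _ ≤ C * (1 + |a|) ^ p * d ^ 2 + D * (1 + |a|) ^ q * d ^ 2 := add_le_add (h a d hd) (h' a d hd)
      _ ≤ C * (1 + |a|) ^ (p + q) * d ^ 2 + D * (1 + |a|) ^ (p + q) * d ^ 2 := by gcongr
      _ = _ := by ring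
  | monomial n c =>
    suffices h : ∃ (C : ℝ) (p : ℕ), 0 ≤ C ∧ ∀ a d : ℝ, |d| ≤ 1 →
        |(a + d) ^ n - a ^ n - n * a ^ (n - 1) * d| ≤ C * (1 + |a|) ^ p * d ^ 2 by
      obtain ⟨C, p, hC, h⟩ := h
      refine ⟨|c| * C, p, by positivity, fun a d hd => ?_⟩
      have e : (monomial n c).eval (a + d) - (monomial n c).eval a
          - (monomial n c).derivative.eval a * d
          = c * ((a + d) ^ n - a ^ n - n * a ^ (n - 1) * d) := by
        simp [derivative_monomial]; ring
      rw [e, abs_mul, mul_assoc |c| C, mul_assoc |c|]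
      exact mul_le_mul_of_nonneg_left (h a d hd) (abs_nonneg c)
    refine ⟨(n : ℝ) ^ 2, n, by positivity, fun a d hd => ?_⟩
    have h1 : (1 : ℝ) ≤ 1 + |a| := by linarith [abs_nonneg a]
    induction n with
    | zero => simp
    | succ n ih =>
      have e : (a + d) ^ (n + 1) - a ^ (n + 1) - ((n + 1 : ℕ) : ℝ) * a ^ (n + 1 - 1) * d
          = (a + d) * ((a + d) ^ n - a ^ n - n * a ^ (n - 1) * d) + n * a ^ (n - 1) * d ^ 2 := by
        rcases n with _ | n
        · simp
        · simp only [Nat.add_sub_cancel]; push_cast; ring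
      rw [e]
      refine (abs_add_le _ _).trans ?_
      have h2 : |a + d| ≤ 1 + |a| := (abs_add_le _ _).trans (by linarith)
      have h3 : |(n : ℝ) * a ^ (n - 1) * d ^ 2| ≤ n * (1 + |a|) ^ (n + 1) * d ^ 2 := by
        rw [abs_mul, abs_mul, abs_pow, abs_of_nonneg (sq_nonneg d), Nat.abs_cast]
        gcongr
        calc |a| ^ (n - 1) ≤ (1 + |a|) ^ (n - 1) := by gcongr; linarith
          _ ≤ _ := pow_le_pow_right₀ h1 (by omega)
      rw [abs_mul]
      calc _ ≤ (1 + |a|) * ((n : ℝ) ^ 2 * (1 + |a|) ^ n * d ^ 2)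
            + n * (1 + |a|) ^ (n + 1) * d ^ 2 := by gcongr
        _ = ((n : ℝ) ^ 2 + n) * (1 + |a|) ^ (n + 1) * d ^ 2 := by ring
        _ ≤ _ := by
          gcongr
          push_cast
          nlinarith [(Nat.cast_nonneg n : (0 : ℝ) ≤ n)]

theorem exists_abs_eval_le (R : ℝ[X]) : ∃ (C : ℝ) (p : ℕ), 0 ≤ C ∧ ∀ a : ℝ,
    |R.eval a| ≤ C * (1 + |a|) ^ p := by
  induction R using Polynomial.induction_on' with
  | add P Q hP hQ =>
    obtain ⟨C, p, hC, h⟩ := hP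
    obtain ⟨D, q, hD, h'⟩ := hQ
    refine ⟨C + D, p + q, by positivity, fun a => ?_⟩
    have h1 : (1 : ℝ) ≤ 1 + |a| := by linarith [abs_nonneg a]
    have hp : (1 + |a|) ^ p ≤ (1 + |a|) ^ (p + q) := pow_le_pow_right₀ h1 (by omega)
    have hq : (1 + |a|) ^ q ≤ (1 + |a|) ^ (p + q) := pow_le_pow_right₀ h1 (by omega)
    rw [eval_add]
    refine (abs_add_le _ _).trans ?_
    calc _ ≤ C * (1 + |a|) ^ p + D * (1 + |a|) ^ q := add_le_add (h a) (h' a)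
      _ ≤ C * (1 + |a|) ^ (p + q) + D * (1 + |a|) ^ (p + q) := by gcongr
      _ = _ := by ring
  | monomial n c =>
    refine ⟨|c|, n, by positivity, fun a => ?_⟩
    rw [eval_monomial, abs_mul, abs_pow]
    gcongr
    linarith

theorem exists_abs_eval_sub_le (R : ℝ[X]) : ∃ (C : ℝ) (p : ℕ), 0 ≤ C ∧ ∀ a d : ℝ, |d| ≤ 1 →
    |R.eval (a + d) - R.eval a| ≤ C * (1 + |a|) ^ p * |d| := by
  obtain ⟨C, p, hC, h⟩ := exists_eval_taylor_le R
  obtain ⟨D, q, hD, h'⟩ := exists_abs_eval_le R.derivative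
  refine ⟨C + D, p + q, by positivity, fun a d hd => ?_⟩
  have h1 : (1 : ℝ) ≤ 1 + |a| := by linarith [abs_nonneg a]
  have hp : (1 + |a|) ^ p ≤ (1 + |a|) ^ (p + q) := pow_le_pow_right₀ h1 (by omega)
  have hq : (1 + |a|) ^ q ≤ (1 + |a|) ^ (p + q) := pow_le_pow_right₀ h1 (by omega)
  have hd2 : d ^ 2 ≤ |d| := by
    rw [← sq_abs]; nlinarith [abs_nonneg d]
  calc |R.eval (a + d) - R.eval a|
      = |(R.eval (a + d) - R.eval a - R.derivative.eval a * d) + R.derivative.eval a * d| := by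
        congr 1; ring
    _ ≤ C * (1 + |a|) ^ p * d ^ 2 + D * (1 + |a|) ^ q * |d| := by
        refine (abs_add_le _ _).trans (add_le_add (h a d hd) ?_)
        rw [abs_mul]
        exact mul_le_mul_of_nonneg_right (h' a) (abs_nonneg d)
    _ ≤ C * (1 + |a|) ^ (p + q) * |d| + D * (1 + |a|) ^ (p + q) * |d| := by gcongr
    _ = _ := by ring

theorem exists_derivative_eq (Q : ℝ[X]) : ∃ R : ℝ[X], R.derivative = Q := by
  induction Q using Polynomial.induction_on' with
  | add P Q hP hQ =>
    obtain ⟨R, rfl⟩ := hP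
    obtain ⟨S, rfl⟩ := hQ
    exact ⟨R + S, derivative_add⟩
  | monomial n c =>
    refine ⟨monomial (n + 1) (c / (n + 1)), ?_⟩
    have : (n : ℝ) + 1 ≠ 0 := by positivity
    rw [derivative_monomial]
    simp [this]

/-! ### Series with terms of size `log^p N / N²` -/

theorem log_succ_sub_log_bounds {N : ℕ} (hN : 1 ≤ N) :
    1 / (N : ℝ) - 1 / (N : ℝ) ^ 2 ≤ Real.log ((N + 1 : ℕ) : ℝ) - Real.log N ∧
      Real.log ((N + 1 : ℕ) : ℝ) - Real.log N ≤ 1 / N := by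
  have hN' : (1 : ℝ) ≤ N := by exact_mod_cast hN
  rw [← Real.log_div (by positivity) (by positivity)]
  constructor
  · refine le_trans ?_ (Real.one_sub_inv_le_log_of_pos (by positivity))
    have e : 1 - (((N + 1 : ℕ) : ℝ) / N)⁻¹ = 1 / (N + 1) := by push_cast; field_simp; ring
    have e' : 1 / (N : ℝ) - 1 / (N : ℝ) ^ 2 = (N - 1) / (N : ℝ) ^ 2 := by field_simp
    rw [e, e', div_le_div_iff₀ (by positivity) (by positivity)]
    nlinarith
  · refine (Real.log_le_sub_one_of_pos (by positivity)).trans (le_of_eq ?_)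
    push_cast; field_simp; ring

/-- A telescoping majorant of `∑ (1 + log N)^p / N²`. -/
theorem exists_telescoping_majorant (p : ℕ) : ∃ (B : ℕ → ℝ) (C : ℝ), 0 ≤ C ∧ ∀ N : ℕ, 1 ≤ N →
    0 ≤ B N ∧ B N ≤ C * (1 + Real.log N) ^ p / N ∧
    (1 + Real.log N) ^ p / (N : ℝ) ^ 2 ≤ B N - B (N + 1) := by
  induction p with
  | zero =>
    refine ⟨fun N => 2 / N, 2, by norm_num, fun N hN => ?_⟩
    have hN' : (1 : ℝ) ≤ N := by exact_mod_cast hN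
    refine ⟨by positivity, by simp, ?_⟩
    have e : 2 / (N : ℝ) - 2 / ((N + 1 : ℕ) : ℝ) = 2 / (N * (N + 1)) := by
      push_cast; field_simp; ring
    simp only [e, pow_zero]
    rw [div_le_div_iff₀ (by positivity) (by positivity)]
    nlinarith
  | succ p ih =>
    obtain ⟨B, C, hC, hB⟩ := ih
    set K : ℝ := 2 * ((p + 1) * 2 ^ p) with hK
    have hK0 : 0 ≤ K := by positivity
    -- The increment of `(1 + log N)^(p+1) / N` has the right main term, but growth of the numerator
    -- loses a term of degree `p` in the logarithm. Adding `K * B` pays for that loss; `K` doubles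
    -- the constant of `hpow`.
    refine ⟨fun N => 2 * ((1 + Real.log N) ^ (p + 1) / N) + K * B N, 2 + K * C,
      by positivity, fun N hN => ?_⟩
    obtain ⟨hB0, hB1, hB2⟩ := hB N hN
    have hN' : (1 : ℝ) ≤ N := by exact_mod_cast hN
    have hL : 0 ≤ Real.log N := Real.log_nonneg hN'
    have hd0 : 0 ≤ Real.log ((N + 1 : ℕ) : ℝ) - Real.log N :=
      sub_nonneg.2 (Real.log_le_log (by linarith) (by push_cast; linarith))
    have hd := (log_succ_sub_log_bounds hN).2
    obtain ⟨d, hdef⟩ : ∃ d, d = Real.log ((N + 1 : ℕ) : ℝ) - Real.log N := ⟨_, rfl⟩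
    have hlog' : Real.log ((N + 1 : ℕ) : ℝ) = Real.log N + d := by rw [hdef]; ring
    rw [← hdef] at hd hd0
    simp only [hlog']
    generalize Real.log N = L at *
    have hd1 : d ≤ 1 := hd.trans (by rw [div_le_one (by positivity)]; exact hN')
    refine ⟨by positivity, ?_, ?_⟩
    · have : (1 + L) ^ p ≤ (1 + L) ^ (p + 1) := pow_le_pow_right₀ (by linarith) (by omega)
      calc _ ≤ 2 * ((1 + L) ^ (p + 1) / N) + K * (C * (1 + L) ^ (p + 1) / N) := by
            gcongr
            exact hB1.trans (by gcongr)
        _ = _ := by ring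
    · have hpow : (1 + (L + d)) ^ (p + 1) - (1 + L) ^ (p + 1)
          ≤ (p + 1) * 2 ^ p * (1 + L) ^ p / N := by
        have h2 := abs_pow_sub_pow_le (1 + (L + d)) (1 + L) (p + 1)
        have hm : max |1 + (L + d)| |1 + L| ≤ 2 * (1 + L) := by
          rw [abs_of_nonneg (by linarith), abs_of_nonneg (by linarith)]
          exact max_le (by linarith) (by linarith)
        have hs : |1 + (L + d) - (1 + L)| ≤ 1 / N := by
          rw [show 1 + (L + d) - (1 + L) = d by ring, abs_of_nonneg hd0]; exact hd
        calc _ ≤ _ := le_abs_self _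
          _ ≤ _ := h2
          _ ≤ 1 / N * ((p + 1 : ℕ) : ℝ) * (2 * (1 + L)) ^ p := by
              simp only [Nat.add_sub_cancel]; gcongr
          _ = _ := by push_cast; rw [mul_pow]; ring
      set X := (1 + L) ^ (p + 1)
      set Y := (1 + (L + d)) ^ (p + 1)
      set Z := (1 + L) ^ p
      have hX : 0 ≤ X := by positivity
      have hZ : 0 ≤ Z := by positivity
      have e : X / N - Y / ((N + 1 : ℕ) : ℝ) = X / (N * (N + 1)) - (Y - X) / (N + 1) := by
        push_cast; field_simp; ring
      have h3 : X / (N : ℝ) ^ 2 ≤ 2 * (X / (N * (N + 1))) := by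
        rw [← mul_div_assoc, div_le_div_iff₀ (by positivity) (by positivity)]
        nlinarith [mul_nonneg hX (mul_nonneg (by linarith : (0 : ℝ) ≤ N)
          (by linarith : (0 : ℝ) ≤ (N : ℝ) - 1))]
      have h4 : 2 * ((Y - X) / (N + 1)) ≤ K * (Z / (N : ℝ) ^ 2) := by
        calc 2 * ((Y - X) / (N + 1)) ≤ 2 * (((p + 1) * 2 ^ p * Z / N) / (N + 1)) := by gcongr
          _ ≤ 2 * (((p + 1) * 2 ^ p * Z / N) / N) := by gcongr; linarith
          _ = _ := by rw [hK]; field_simp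
      have h5 : K * (Z / (N : ℝ) ^ 2) ≤ K * (B N - B (N + 1)) := by gcongr
      nlinarith

/-- A series with terms `O((1 + log N)^p / N²)` converges with remainder `O((1 + log N)^p / N)`. -/
theorem exists_sum_sub_le {a : ℕ → ℝ} {K : ℝ} {p : ℕ}
    (ha : ∀ N : ℕ, 1 ≤ N → |a N| ≤ K * ((1 + Real.log N) ^ p / (N : ℝ) ^ 2)) :
    ∃ c C : ℝ, 0 ≤ C ∧ ∀ N : ℕ, 1 ≤ N →
      |(∑ M ∈ Finset.Ioo 0 N, a M) - c| ≤ C * (1 + Real.log N) ^ p / N := by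
  have hK : 0 ≤ K := by simpa using (abs_nonneg _).trans (ha 1 le_rfl)
  obtain ⟨B, C, hC, hB⟩ := exists_telescoping_majorant p
  have hsucc : ∀ N, 1 ≤ N →
      ∑ M ∈ Finset.Ioo 0 (N + 1), a M = ∑ M ∈ Finset.Ioo 0 N, a M + a N := by
    intro N hN
    rw [show Finset.Ioo 0 (N + 1) = insert N (Finset.Ioo 0 N) by ext; simp; omega,
      Finset.sum_insert (by simp), add_comm]
  set S : ℕ → ℝ := fun N => ∑ M ∈ Finset.Ioo 0 N, a M with hS
  have hdiff : ∀ N, 1 ≤ N → ∀ j, |S (N + j) - S N| ≤ K * (B N - B (N + j)) := by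
    intro N hN j
    induction j with
    | zero => simp
    | succ j ih =>
      have h1 : S (N + (j + 1)) - S N = (S (N + j) - S N) + a (N + j) := by
        have := hsucc (N + j) (by omega)
        simp only [hS, ← add_assoc] at this ⊢
        rw [this]; ring
      rw [h1]
      have h2 := (ha (N + j) (by omega)).trans
        (mul_le_mul_of_nonneg_left (hB (N + j) (by omega)).2.2 hK)
      refine (abs_add_le _ _).trans ((add_le_add ih h2).trans (le_of_eq ?_))
      rw [← add_assoc]; ring
  have hdiff' : ∀ N, 1 ≤ N → ∀ j, |S (N + j) - S N| ≤ K * B N := fun N hN j =>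
    (hdiff N hN j).trans (mul_le_mul_of_nonneg_left (by linarith [(hB (N + j) (by omega)).1]) hK)
  have hlim : Tendsto (fun N : ℕ => C * (1 + Real.log N) ^ p / N) atTop (𝓝 0) := by
    have h1 : Tendsto (fun y : ℝ => (1 + Real.log y) ^ p / y) atTop (𝓝 0) := by
      -- Evaluating at `e * y` turns `log` into `1 + log y`.
      have h2 := (Real.isLittleO_pow_log_id_atTop (n := p)).tendsto_div_nhds_zero
      have h3 := h2.comp (tendsto_id.const_mul_atTop (Real.exp_pos 1))
      have h4 := h3.mul_const (Real.exp 1)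
      rw [zero_mul] at h4
      refine h4.congr' ?_
      filter_upwards [eventually_gt_atTop 0] with y hy
      have he := (Real.exp_pos 1).ne'
      simp only [Function.comp, id]
      rw [Real.log_mul he hy.ne', Real.log_exp]
      field_simp
    have h2 := (h1.comp tendsto_natCast_atTop_atTop).const_mul C
    simpa [mul_div_assoc] using h2
  have hcau : CauchySeq fun N => S (N + 1) := by
    refine cauchySeq_of_le_tendsto_0'
      (fun N => K * (C * (1 + Real.log (N + 1 : ℕ)) ^ p / (N + 1 : ℕ))) (fun n m hnm => ?_) ?_
    · obtain ⟨j, rfl⟩ := Nat.exists_eq_add_of_le hnm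
      rw [dist_comm, Real.dist_eq, show n + j + 1 = (n + 1) + j by ring]
      exact (hdiff' (n + 1) (by omega) j).trans
        (mul_le_mul_of_nonneg_left (hB (n + 1) (by omega)).2.1 hK)
    · simpa using ((tendsto_add_atTop_iff_nat 1).2 hlim).const_mul K
  obtain ⟨c, hc⟩ := cauchySeq_tendsto_of_complete hcau
  have hc' : Tendsto S atTop (𝓝 c) := (tendsto_add_atTop_iff_nat 1).1 hc
  refine ⟨c, K * C, by positivity, fun N hN => ?_⟩
  have h1 : Tendsto (fun j => |S N - S (N + j)|) atTop (𝓝 |S N - c|) := by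
    refine (tendsto_const_nhds.sub ?_).abs
    simpa [add_comm] using (tendsto_add_atTop_iff_nat N).2 hc'
  refine (le_of_tendsto' h1 fun j => ?_).trans
    ((mul_le_mul_of_nonneg_left (hB N hN).2.1 hK).trans (le_of_eq (by ring)))
  rw [abs_sub_comm]
  exact hdiff' N hN j

/-! ### Expansion of the truncated sums -/

theorem zetaTrunc_nonneg {x : ℝ} (hx : |x| < 1) {r : ℕ} (k : Fin r → ℕ+) (N : ℕ) :
    0 ≤ zetaTrunc x k N := by
  refine Finset.sum_nonneg fun m hm => ?_
  have h : ∀ i, 0 < (m i : ℝ) + x := by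
    intro i
    have h1 : 0 < m i := by simp at hm; exact (hm.1 i).1
    have h2 : (1 : ℝ) ≤ m i := by exact_mod_cast h1
    linarith [(abs_lt.1 hx).1]
  exact one_div_nonneg.2 (Finset.prod_nonneg fun i _ => (pow_pos (h i) _).le)

theorem zetaTrunc_zero (x : ℝ) (k : Fin 0 → ℕ+) (N : ℕ) : zetaTrunc x k N = 1 := by
  classical
  rw [zetaTrunc, Finset.filter_true_of_mem (fun m _ => Subsingleton.strictMono m)]
  simp

/-- Group the tuples by their largest entry `M`. The strict bound `m_r < N` makes the remaining
entries range over exactly the tuples counted at level `M`. -/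
theorem zetaTrunc_succ (x : ℝ) {r : ℕ} (k : Fin (r + 1) → ℕ+) (N : ℕ) :
    zetaTrunc x k N = ∑ M ∈ Finset.Ioo 0 N,
      zetaTrunc x (fun i : Fin r => k i.castSucc) M / ((M : ℝ) + x) ^ (k (Fin.last r) : ℕ) := by
  classical
  simp only [zetaTrunc, Finset.sum_div]
  rw [Finset.sum_sigma']
  symm
  refine Finset.sum_bij' (fun a _ => (Fin.snoc a.2 a.1 : Fin (r + 1) → ℕ))
    (fun m _ => ⟨m (Fin.last r), fun i => m i.castSucc⟩) ?_ ?_ ?_ ?_ ?_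
  · rintro ⟨M, m⟩ h
    simp only [Finset.mem_sigma, Finset.mem_Ioo, Finset.mem_filter, Fintype.mem_piFinset] at h
    simp only [Finset.mem_Ioo, Finset.mem_filter, Fintype.mem_piFinset]
    obtain ⟨⟨h1, h2⟩, h3, h4⟩ := h
    refine ⟨fun i => ?_, ?_⟩
    · refine Fin.lastCases ?_ (fun j => ?_) i
      · simpa using ⟨h1, h2⟩
      · simpa using ⟨(h3 j).1, (h3 j).2.trans h2⟩
    · intro i
      refine Fin.lastCases ?_ (fun i => ?_) i
      · intro j hij; exact absurd hij (not_lt.2 (Fin.le_last j))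
      · intro j
        refine Fin.lastCases ?_ (fun j => ?_) j
        · intro _; simpa using (h3 i).2
        · intro hij; simpa using h4 (by simpa using hij)
  · intro m h
    simp only [Finset.mem_Ioo, Finset.mem_filter, Fintype.mem_piFinset] at h
    simp only [Finset.mem_sigma, Finset.mem_Ioo, Finset.mem_filter, Fintype.mem_piFinset]
    exact ⟨h.1 _, fun i => ⟨(h.1 _).1, h.2 (Fin.castSucc_lt_last i)⟩,
      fun i j hij => h.2 (Fin.castSucc_lt_castSucc_iff.2 hij)⟩
  · rintro ⟨M, m⟩ h
    simp
  · intro m h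
    ext i
    refine Fin.lastCases ?_ (fun j => ?_) i <;> simp
  · rintro ⟨M, m⟩ h
    rw [Fin.prod_univ_castSucc]
    simp [div_eq_mul_inv, mul_comm]

theorem exists_le_of_le_add {f g h F : ℕ → ℝ} {A B D : ℝ} {p q s : ℕ}
    (hA : 0 ≤ A) (hB : 0 ≤ B) (hD : 0 ≤ D) (hF : ∀ N, |F N| ≤ f N + g N + h N)
    (hf : ∀ N : ℕ, 1 ≤ N → f N ≤ A * ((1 + Real.log N) ^ p / (N : ℝ) ^ 2))
    (hg : ∀ N : ℕ, 1 ≤ N → g N ≤ B * ((1 + Real.log N) ^ q / (N : ℝ) ^ 2))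
    (hh : ∀ N : ℕ, 1 ≤ N → h N ≤ D * ((1 + Real.log N) ^ s / (N : ℝ) ^ 2)) (N : ℕ) (hN : 1 ≤ N) :
    |F N| ≤ (A + B + D) * ((1 + Real.log N) ^ (p + q + s) / (N : ℝ) ^ 2) := by
  have hL : 0 ≤ Real.log N := Real.log_nonneg (by exact_mod_cast hN)
  have hp : (1 + Real.log N) ^ p ≤ (1 + Real.log N) ^ (p + q + s) :=
    pow_le_pow_right₀ (by linarith) (by omega)
  have hq : (1 + Real.log N) ^ q ≤ (1 + Real.log N) ^ (p + q + s) :=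
    pow_le_pow_right₀ (by linarith) (by omega)
  have hs : (1 + Real.log N) ^ s ≤ (1 + Real.log N) ^ (p + q + s) :=
    pow_le_pow_right₀ (by linarith) (by omega)
  calc _ ≤ _ := hF N
    _ ≤ A * ((1 + Real.log N) ^ p / (N : ℝ) ^ 2) + B * ((1 + Real.log N) ^ q / (N : ℝ) ^ 2)
        + D * ((1 + Real.log N) ^ s / (N : ℝ) ^ 2) :=
      add_le_add (add_le_add (hf N hN) (hg N hN)) (hh N hN)
    _ ≤ A * ((1 + Real.log N) ^ (p + q + s) / (N : ℝ) ^ 2)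
        + B * ((1 + Real.log N) ^ (p + q + s) / (N : ℝ) ^ 2)
        + D * ((1 + Real.log N) ^ (p + q + s) / (N : ℝ) ^ 2) := by gcongr
    _ = _ := by ring

theorem mul_le_natCast_add (x : ℝ) {M : ℕ} (hM : 1 ≤ M) :
    (1 - |x|) * M ≤ M + x := by
  have hM' : (1 : ℝ) ≤ M := by exact_mod_cast hM
  nlinarith [neg_abs_le x, abs_nonneg x]

theorem sum_Ioo_sub_telescope (R : ℕ → ℝ) {N : ℕ} (hN : 1 ≤ N) :
    ∑ M ∈ Finset.Ioo 0 N, (R (M + 1) - R M) = R N - R 1 := by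
  rw [show Finset.Ioo 0 N = Finset.Ico 1 N by ext; simp; omega]
  exact Finset.sum_Ico_sub R hN

/-- Summation against `(M + x)^{-κ}` with `κ ≥ 2` preserves asymptotic expansions in `log N`. -/
theorem exists_asymp_sum_div_pow {x : ℝ} (hx : |x| < 1) {F : ℕ → ℝ} {W : ℝ[X]} {C : ℝ} {p : ℕ}
    (hC : 0 ≤ C) (hF : ∀ N : ℕ, 1 ≤ N → |F N - W.eval (Real.log N)| ≤ C * (1 + Real.log N) ^ p / N)
    {κ : ℕ} (hκ : 2 ≤ κ) :
    ∃ (V : ℝ[X]) (D : ℝ) (q : ℕ), 0 ≤ D ∧ ∀ N : ℕ, 1 ≤ N →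
      |(∑ M ∈ Finset.Ioo 0 N, F M / ((M : ℝ) + x) ^ κ) - V.eval (Real.log N)|
        ≤ D * (1 + Real.log N) ^ q / N := by
  obtain ⟨E, s, hE, hW⟩ := exists_abs_eval_le W
  have hβ : 0 < 1 - |x| := by linarith
  have key : ∀ N : ℕ, 1 ≤ N → |F N / ((N : ℝ) + x) ^ κ|
      ≤ ((C + E) / (1 - |x|) ^ κ) * ((1 + Real.log N) ^ (p + s) / (N : ℝ) ^ 2) := by
    intro N hN
    have hN' : (1 : ℝ) ≤ N := by exact_mod_cast hN
    have hL : 0 ≤ Real.log N := Real.log_nonneg hN'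
    have hp : (1 + Real.log N) ^ p ≤ (1 + Real.log N) ^ (p + s) :=
      pow_le_pow_right₀ (by linarith) (by omega)
    have hs : (1 + Real.log N) ^ s ≤ (1 + Real.log N) ^ (p + s) :=
      pow_le_pow_right₀ (by linarith) (by omega)
    have h1 : |F N| ≤ (C + E) * (1 + Real.log N) ^ (p + s) := by
      have h2 := hW (Real.log N)
      rw [abs_of_nonneg hL] at h2
      have h3 : C * (1 + Real.log N) ^ p / N ≤ C * (1 + Real.log N) ^ p :=
        div_le_self (by positivity) hN'
      calc |F N| = |(F N - W.eval (Real.log N)) + W.eval (Real.log N)| := by congr 1; ring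
        _ ≤ C * (1 + Real.log N) ^ p + E * (1 + Real.log N) ^ s :=
          (abs_add_le _ _).trans (add_le_add ((hF N hN).trans h3) h2)
        _ ≤ C * (1 + Real.log N) ^ (p + s) + E * (1 + Real.log N) ^ (p + s) := by gcongr
        _ = _ := by ring
    have h2 : (1 - |x|) ^ κ * (N : ℝ) ^ 2 ≤ ((N : ℝ) + x) ^ κ := by
      calc (1 - |x|) ^ κ * (N : ℝ) ^ 2 ≤ (1 - |x|) ^ κ * (N : ℝ) ^ κ := by
            gcongr
        _ = ((1 - |x|) * N) ^ κ := (mul_pow _ _ _).symm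
        _ ≤ _ := by
          gcongr
          exact mul_le_natCast_add x hN
    rw [abs_div, abs_of_nonneg ((by positivity : (0 : ℝ) ≤ _).trans h2)]
    calc _ ≤ (C + E) * (1 + Real.log N) ^ (p + s) / ((1 - |x|) ^ κ * (N : ℝ) ^ 2) := by gcongr
      _ = _ := by field_simp
  obtain ⟨c, D, hD, h⟩ := exists_sum_sub_le key
  exact ⟨Polynomial.C c, D, _, hD, fun N hN => by simpa using h N hN⟩

/-- Summation against `(M + x)⁻¹` preserves asymptotic expansions in `log N`. -/
theorem exists_asymp_sum_div {x : ℝ} (hx : |x| < 1) {F : ℕ → ℝ} {W : ℝ[X]} {C : ℝ} {p : ℕ}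
    (hC : 0 ≤ C)
    (hF : ∀ N : ℕ, 1 ≤ N → |F N - W.eval (Real.log N)| ≤ C * (1 + Real.log N) ^ p / N) :
    ∃ (V : ℝ[X]) (D : ℝ) (q : ℕ), 0 ≤ D ∧ ∀ N : ℕ, 1 ≤ N →
      |(∑ M ∈ Finset.Ioo 0 N, F M / ((M : ℝ) + x)) - V.eval (Real.log N)|
        ≤ D * (1 + Real.log N) ^ q / N := by
  obtain ⟨E, s, hE, hW⟩ := exists_abs_eval_le W
  obtain ⟨R, hR⟩ := exists_derivative_eq W
  obtain ⟨T, u, hT, hTay⟩ := exists_eval_taylor_le R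
  have hβ : 0 < 1 - |x| := by linarith
  -- `a` compares the summand with the increment of `R(log N)`, where `R' = W`. Its three errors:
  -- `f` replaces `F` by `W`, `g` replaces `1/(N + x)` by the increment of `log`, and `h` is the
  -- Taylor remainder of `R`.
  set a : ℕ → ℝ := fun N => F N / ((N : ℝ) + x)
    - (R.eval (Real.log ((N + 1 : ℕ) : ℝ)) - R.eval (Real.log N)) with ha
  set f : ℕ → ℝ := fun N => |(F N - W.eval (Real.log N)) / ((N : ℝ) + x)|
  set g : ℕ → ℝ := fun N => |W.eval (Real.log N)
    * (1 / ((N : ℝ) + x) - (Real.log ((N + 1 : ℕ) : ℝ) - Real.log N))|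
  set h : ℕ → ℝ := fun N => |R.eval (Real.log N + (Real.log ((N + 1 : ℕ) : ℝ) - Real.log N))
    - R.eval (Real.log N) - R.derivative.eval (Real.log N)
      * (Real.log ((N + 1 : ℕ) : ℝ) - Real.log N)|
  have hsum : ∀ N, |a N| ≤ f N + g N + h N := by
    intro N
    refine le_trans (le_of_eq ?_) ((abs_sub _ _).trans (add_le_add_left (abs_add_le _ _) _))
    rw [ha, hR]
    simp only [add_sub_cancel]
    congr 1
    ring
  have hf : ∀ N : ℕ, 1 ≤ N → f N ≤ (C / (1 - |x|)) * ((1 + Real.log N) ^ p / (N : ℝ) ^ 2) := by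
    intro N hN
    have hN' : (1 : ℝ) ≤ N := by exact_mod_cast hN
    have hL : 0 ≤ Real.log N := Real.log_nonneg hN'
    have h2 := mul_le_natCast_add x hN
    simp only [f]
    rw [abs_div, abs_of_nonneg ((by positivity : (0 : ℝ) ≤ _).trans h2)]
    calc _ ≤ (C * (1 + Real.log N) ^ p / N) / ((1 - |x|) * N) := by
          gcongr
          exact hF N hN
      _ = _ := by field_simp
  have hg : ∀ N : ℕ, 1 ≤ N →
      g N ≤ (E * (1 / (1 - |x|) + 1)) * ((1 + Real.log N) ^ s / (N : ℝ) ^ 2) := by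
    intro N hN
    have hN' : (1 : ℝ) ≤ N := by exact_mod_cast hN
    have hL : 0 ≤ Real.log N := Real.log_nonneg hN'
    have h2 := mul_le_natCast_add x hN
    have hpos : 0 < (N : ℝ) + x := (by positivity : (0 : ℝ) < (1 - |x|) * N).trans_le h2
    have h3 := hW (Real.log N)
    rw [abs_of_nonneg hL] at h3
    have h4 : |1 / ((N : ℝ) + x) - 1 / N| ≤ 1 / (1 - |x|) / (N : ℝ) ^ 2 := by
      have e : 1 / ((N : ℝ) + x) - 1 / N = -x / ((N + x) * N) := by field_simp; ring
      rw [e, abs_div, abs_neg, abs_of_nonneg (by positivity : 0 ≤ ((N : ℝ) + x) * N)]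
      calc |x| / (((N : ℝ) + x) * N) ≤ 1 / (((1 - |x|) * N) * N) := by gcongr
        _ = _ := by field_simp
    have h5 := log_succ_sub_log_bounds hN
    have h6 : |1 / (N : ℝ) - (Real.log ((N + 1 : ℕ) : ℝ) - Real.log N)| ≤ 1 / (N : ℝ) ^ 2 := by
      rw [abs_of_nonneg (by linarith)]; linarith
    have h7 : |1 / ((N : ℝ) + x) - (Real.log ((N + 1 : ℕ) : ℝ) - Real.log N)|
        ≤ (1 / (1 - |x|) + 1) / (N : ℝ) ^ 2 := by
      rw [add_div]
      exact (abs_sub_le _ (1 / (N : ℝ)) _).trans (add_le_add h4 h6)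
    simp only [g]
    rw [abs_mul]
    calc _ ≤ (E * (1 + Real.log N) ^ s) * ((1 / (1 - |x|) + 1) / (N : ℝ) ^ 2) := by gcongr
      _ = _ := by ring
  have hh : ∀ N : ℕ, 1 ≤ N → h N ≤ T * ((1 + Real.log N) ^ u / (N : ℝ) ^ 2) := by
    intro N hN
    have hN' : (1 : ℝ) ≤ N := by exact_mod_cast hN
    have hL : 0 ≤ Real.log N := Real.log_nonneg hN'
    have h5 := (log_succ_sub_log_bounds hN).2
    have h6 : 0 ≤ Real.log ((N + 1 : ℕ) : ℝ) - Real.log N :=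
      sub_nonneg.2 (Real.log_le_log (by linarith) (by push_cast; linarith))
    have h7 : 1 / (N : ℝ) ≤ 1 := by rw [div_le_one (by positivity)]; exact hN'
    have h8 := hTay (Real.log N) _ ((abs_of_nonneg h6).le.trans (h5.trans h7))
    rw [abs_of_nonneg hL] at h8
    refine h8.trans ?_
    calc _ ≤ T * (1 + Real.log N) ^ u * (1 / (N : ℝ)) ^ 2 := by gcongr
      _ = _ := by ring
  obtain ⟨c, D, hD, hfin⟩ := exists_sum_sub_le
    (exists_le_of_le_add (by positivity) (by positivity) hT hsum hf hg hh)
  refine ⟨R - Polynomial.C (R.eval (Real.log ((1 : ℕ) : ℝ))) + Polynomial.C c, D, p + s + u, hD,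
    fun N hN => ?_⟩
  have h1 := hfin N hN
  rw [ha, Finset.sum_sub_distrib,
    sum_Ioo_sub_telescope (fun M : ℕ => R.eval (Real.log (M : ℝ))) hN] at h1
  simp only [eval_add, eval_sub, eval_C]
  convert h1 using 2
  ring

theorem exists_zetaTrunc_asymp {x : ℝ} (hx : |x| < 1) {r : ℕ} (k : Fin r → ℕ+) :
    ∃ (W : ℝ[X]) (C : ℝ) (p : ℕ), 0 ≤ C ∧ ∀ N : ℕ, 1 ≤ N →
      |zetaTrunc x k N - W.eval (Real.log N)| ≤ C * (1 + Real.log N) ^ p / N := by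
  induction r with
  | zero => exact ⟨1, 0, 0, le_rfl, fun N _ => by simp [zetaTrunc_zero]⟩
  | succ r ih =>
    obtain ⟨W, C, p, hC, h⟩ := ih fun i => k i.castSucc
    simp only [zetaTrunc_succ]
    rcases eq_or_lt_of_le (one_le (a := k (Fin.last r))) with h1 | h1
    · simp only [← h1, PNat.one_coe, pow_one]
      exact exists_asymp_sum_div hx hC h
    · exact exists_asymp_sum_div_pow hx hC h (by exact_mod_cast h1)

/-! ### The exponential law and `ρ` as an average -/

open MeasureTheory ProbabilityTheory Set

/-- The law of a standard exponential random variable. -/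
noncomputable def expLaw : Measure ℝ :=
  (volume.restrict (Ioi 0)).withDensity fun v => ENNReal.ofReal (Real.exp (-v))

theorem integral_expLaw (f : ℝ → ℝ) :
    ∫ v, f v ∂expLaw = ∫ v in Ioi 0, Real.exp (-v) * f v := by
  rw [expLaw, integral_withDensity_eq_integral_toReal_smul (by fun_prop) (by simp)]
  simp [ENNReal.toReal_ofReal (Real.exp_pos _).le]

theorem integrable_expLaw_iff (f : ℝ → ℝ) :
    Integrable f expLaw ↔ IntegrableOn (fun v => Real.exp (-v) * f v) (Ioi 0) := by
  rw [expLaw, integrable_withDensity_iff_integrable_smul' (by fun_prop) (by simp), IntegrableOn]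
  simp [ENNReal.toReal_ofReal (Real.exp_pos _).le]

theorem ae_pos_expLaw : ∀ᵐ v ∂expLaw, 0 < v :=
  (withDensity_absolutelyContinuous _ _).ae_le (ae_restrict_mem measurableSet_Ioi)

theorem expLaw_Ici {a : ℝ} (ha : 0 ≤ a) : expLaw (Ici a) = ENNReal.ofReal (Real.exp (-a)) := by
  rw [expLaw, withDensity_apply _ measurableSet_Ici, Measure.restrict_restrict measurableSet_Ici,
    setLIntegral_congr (t := Ioi a), ← ofReal_integral_eq_lintegral_ofReal,
    integral_exp_neg_Ioi]
  · exact integrableOn_exp_neg_Ioi a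
  · exact ae_of_all _ fun v => (Real.exp_pos _).le
  · rcases ha.eq_or_lt with rfl | ha
    · rw [inter_eq_right.2 Ioi_subset_Ici_self]
      exact ae_eq_refl _
    · rw [inter_eq_left.2 (Ici_subset_Ioi.2 ha)]
      exact Ioi_ae_eq_Ici.symm

theorem isProbabilityMeasure_expLaw : IsProbabilityMeasure expLaw := by
  refine ⟨?_⟩
  have h : (univ : Set ℝ) =ᵐ[expLaw] Ici 0 := by
    filter_upwards [ae_pos_expLaw] with v hv
    exact propext ⟨fun _ => hv.le, fun _ => trivial⟩
  rw [measure_congr h, expLaw_Ici le_rfl]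
  simp

theorem integrable_rpow_expLaw {y : ℝ} (hy : -1 < y) :
    Integrable (fun v : ℝ => v ^ y) expLaw := by
  rw [integrable_expLaw_iff]
  simpa using Real.GammaIntegral_convergent (s := y + 1) (by linarith)

theorem integral_rpow_expLaw {y : ℝ} (hy : -1 < y) :
    ∫ v : ℝ, v ^ y ∂expLaw = Real.Gamma (1 + y) := by
  rw [integral_expLaw, Real.Gamma_eq_integral (by linarith)]
  simp

/-- A random variable with moment generating function `e^{γ y} Γ(1 + y)`. -/
noncomputable def shiftedLog (v : ℝ) : ℝ := Real.eulerMascheroniConstant + Real.log v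

theorem exp_mul_shiftedLog_ae_eq (y : ℝ) : (fun v => Real.exp (y * shiftedLog v)) =ᵐ[expLaw]
    fun v => Real.exp (Real.eulerMascheroniConstant * y) * v ^ y := by
  filter_upwards [ae_pos_expLaw] with v hv
  rw [shiftedLog, Real.rpow_def_of_pos hv, ← Real.exp_add]
  congr 1
  ring

theorem mgf_shiftedLog {y : ℝ} (hy : -1 < y) : mgf shiftedLog expLaw y
    = Real.exp (Real.eulerMascheroniConstant * y) * Real.Gamma (1 + y) := by
  rw [mgf, integral_congr_ae (exp_mul_shiftedLog_ae_eq y), integral_const_mul,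
    integral_rpow_expLaw hy]

theorem zero_mem_interior_integrableExpSet :
    (0 : ℝ) ∈ interior (integrableExpSet shiftedLog expLaw) := by
  rw [mem_interior_iff_mem_nhds]
  filter_upwards [Ioi_mem_nhds (show (-1 : ℝ) < 0 by norm_num)] with y hy
  exact ((integrable_rpow_expLaw hy).const_mul _).congr (exp_mul_shiftedLog_ae_eq y).symm

theorem integrable_shiftedLog_pow (n : ℕ) :
    Integrable (fun v => shiftedLog v ^ n) expLaw :=
  integrable_pow_of_mem_interior_integrableExpSet zero_mem_interior_integrableExpSet n

/-- Near `0` the function `e^{γy} Γ(1+y)` is a moment generating function, so its derivatives there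
are moments. -/
theorem coeff_gammaSeries (n : ℕ) :
    PowerSeries.coeff n gammaSeries = (∫ v, shiftedLog v ^ n ∂expLaw) / n.factorial := by
  have h : (fun y : ℝ => Real.exp (Real.eulerMascheroniConstant * y) * Real.Gamma (1 + y))
      =ᶠ[𝓝 0] mgf shiftedLog expLaw := by
    filter_upwards [Ioi_mem_nhds (show (-1 : ℝ) < 0 by norm_num)] with y hy
    exact (mgf_shiftedLog hy).symm
  rw [gammaSeries, PowerSeries.coeff_mk, h.iteratedDeriv_eq,
    iteratedDeriv_mgf_zero zero_mem_interior_integrableExpSet]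
  rfl

theorem integrable_eval_add_shiftedLog (W : ℝ[X]) (a : ℝ) :
    Integrable (fun v => W.eval (a + shiftedLog v)) expLaw := by
  have h : ∀ v, W.eval (a + shiftedLog v)
      = ∑ i ∈ Finset.range ((W.comp (Polynomial.C a + X)).natDegree + 1),
        (W.comp (Polynomial.C a + X)).coeff i * shiftedLog v ^ i := by
    intro v
    rw [← eval_eq_sum_range, eval_comp]
    simp
  simp only [h]
  exact integrable_finsetSum _ fun i _ => (integrable_shiftedLog_pow i).const_mul _

theorem rho_monomial_one (n : ℕ) : rho (monomial n 1) =
    (n.factorial : ℝ) • PowerSeries.coeff n (PowerSeries.map C gammaSeries * expTy) := by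
  have h : monomial n (1 : ℝ) = basisMonomials ℝ n := by rw [coe_basisMonomials]
  rw [rho, h, Module.Basis.constr_basis]

/-- `ρ` averages a polynomial over shifts by `γ + log v`, where `v` is exponentially distributed. -/
theorem eval_rho (W : ℝ[X]) (a : ℝ) :
    (rho W).eval a = ∫ v, W.eval (a + shiftedLog v) ∂expLaw := by
  induction W using Polynomial.induction_on' with
  | add P Q hP hQ =>
    simp only [map_add, eval_add, hP, hQ]
    rw [integral_add (integrable_eval_add_shiftedLog P a) (integrable_eval_add_shiftedLog Q a)]
  | monomial n c =>
    have hc : monomial n c = c • monomial n (1 : ℝ) := by rw [smul_monomial]; simp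
    rw [hc, map_smul]
    simp only [eval_smul, smul_eq_mul, integral_const_mul]
    congr 1
    rw [rho_monomial_one, PowerSeries.coeff_mul]
    simp only [eval_smul, eval_finsetSum, PowerSeries.coeff_map, eval_mul, eval_C, expTy,
      PowerSeries.coeff_mk, eval_monomial, coeff_gammaSeries, smul_eq_mul, one_mul]
    -- Binomial expansion of the shifted power, matched term by term with the Cauchy product
    -- defining `ρ`.
    simp only [add_comm a, fun b : ℝ => (Commute.all b a).add_pow' n, nsmul_eq_mul]
    rw [integral_finsetSum, Finset.mul_sum]
    · refine Finset.sum_congr rfl fun ij hij => ?_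
      obtain ⟨i, j⟩ := ij
      obtain rfl := Finset.HasAntidiagonal.mem_antidiagonal.1 hij
      simp only [integral_const_mul, integral_mul_const]
      have h1 : (((i + j).choose i : ℕ) : ℝ) * i.factorial * j.factorial = (i + j).factorial := by
        rw [Nat.choose_symm_add]
        exact_mod_cast Nat.add_choose_mul_factorial_mul_factorial i j
      rw [← h1]
      field_simp
    · intro ij _
      exact ((integrable_shiftedLog_pow _).mul_const _).const_mul _

/-! ### The polylogarithm as an expectation -/

theorem prod_natCast_add_pow_pos {x : ℝ} (hx : |x| < 1) {r : ℕ} (k : Fin r → ℕ+) {m : Fin r → ℕ}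
    (hm : ∀ i, 0 < m i) : 0 < ∏ i, ((m i : ℝ) + x) ^ (k i : ℕ) := by
  refine Finset.prod_pos fun i _ => pow_pos ?_ _
  have h2 : (1 : ℝ) ≤ m i := by exact_mod_cast hm i
  linarith [(abs_lt.1 hx).1]

/-- The sum is taken in `ENNReal` so that it can later be exchanged with the integral without a
convergence proof. The shift to `n + 1` reflects the strict upper bound in `zetaTrunc`. -/
theorem tsum_ite_last_le_eq_zetaTrunc {x : ℝ} (hx : |x| < 1) {r : ℕ} (k : Fin (r + 1) → ℕ+)
    (n : ℕ) :
    ∑' m : {m : Fin (r + 1) → ℕ // StrictMono m ∧ ∀ i, 0 < m i},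
      (if m.1 (Fin.last r) ≤ n then
        ENNReal.ofReal (1 / ∏ i, ((m.1 i : ℝ) + x) ^ (k i : ℕ)) else 0)
      = ENNReal.ofReal (zetaTrunc x k (n + 1)) := by
  classical
  set S : Set (Fin (r + 1) → ℕ) := {m | StrictMono m ∧ ∀ i, 0 < m i} with hS
  set f : (Fin (r + 1) → ℕ) → ENNReal := fun m => if m (Fin.last r) ≤ n then
        ENNReal.ofReal (1 / ∏ i, ((m i : ℝ) + x) ^ (k i : ℕ)) else 0 with hf
  have h1 := tsum_subtype S f
  refine h1.trans ?_
  rw [zetaTrunc, ENNReal.ofReal_sum_of_nonneg, tsum_eq_sum (s := (Fintype.piFinset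
    fun _ : Fin (r + 1) => Finset.Ioo 0 (n + 1)).filter StrictMono)]
  · refine Finset.sum_congr rfl fun m hm => ?_
    simp only [Finset.mem_Ioo, Finset.mem_filter, Fintype.mem_piFinset] at hm
    have hmS : m ∈ S := ⟨hm.2, fun i => (hm.1 i).1⟩
    rw [indicator_of_mem hmS, hf]
    exact if_pos (Nat.lt_succ_iff.1 (hm.1 _).2)
  · intro m hm
    by_cases hmS : m ∈ S
    · rw [indicator_of_mem hmS, hf]
      refine if_neg fun hle => hm ?_
      simp only [Finset.mem_Ioo, Finset.mem_filter, Fintype.mem_piFinset]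
      exact ⟨fun i => ⟨hmS.2 i, Nat.lt_succ_iff.2 ((hmS.1.monotone (Fin.le_last i)).trans hle)⟩,
        hmS.1⟩
    · exact indicator_of_notMem hmS _
  · intro m hm
    simp only [Finset.mem_Ioo, Finset.mem_filter, Fintype.mem_piFinset] at hm
    exact (one_div_pos.2 (prod_natCast_add_pow_pos hx k fun i => (hm.1 i).1)).le

/-- The event is `v ≥ M s`, of probability `e^{-Ms}`. For `M = 0` it would also include negative
`v`. -/
theorem lintegral_ite_le_floor {s c : ℝ} (hs : 0 < s) (hc : 0 ≤ c) {M : ℕ} (hM : 0 < M) :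
    ∫⁻ v, (if M ≤ ⌊v / s⌋₊ then ENNReal.ofReal c else 0) ∂expLaw
      = ENNReal.ofReal (Real.exp (-s) ^ M * c) := by
  have h : (fun v : ℝ => if M ≤ ⌊v / s⌋₊ then ENNReal.ofReal c else 0)
      = (Ici (M * s)).indicator fun _ => ENNReal.ofReal c := by
    ext v
    simp only [indicator, mem_Ici, Nat.le_floor_iff' hM.ne', le_div_iff₀ hs]
  rw [h, lintegral_indicator_const measurableSet_Ici, expLaw_Ici (by positivity),
    ← ENNReal.ofReal_mul hc, mul_comm, ← Real.exp_nat_mul]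
  congr 3
  ring

theorem measurable_comp_floor (F : ℕ → ℝ) (s : ℝ) : Measurable fun v : ℝ => F (⌊v / s⌋₊ + 1) :=
  (measurable_from_nat (f := fun n => F (n + 1))).comp
    (Nat.measurable_floor.comp (measurable_id.div_const s))

/-- Abel summation for the polylogarithm, in probabilistic form. -/
theorem hurwitzLi_eq_integral {x : ℝ} (hx : |x| < 1) {r : ℕ} (k : Fin (r + 1) → ℕ+) {t : ℝ}
    (ht0 : 0 < t) (ht1 : t < 1) :
    hurwitzLi x k t = t ^ x * ∫ v, zetaTrunc x k (⌊v / (-Real.log t)⌋₊ + 1) ∂expLaw := by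
  have hs : 0 < -Real.log t := by linarith [Real.log_neg ht0 ht1]
  have hexp : Real.exp (-(-Real.log t)) = t := by rw [neg_neg, Real.exp_log ht0]
  have hpos : ∀ m : {m : Fin (r + 1) → ℕ // StrictMono m ∧ ∀ i, 0 < m i},
      0 ≤ 1 / ∏ i, ((m.1 i : ℝ) + x) ^ (k i : ℕ) := fun m =>
    (one_div_pos.2 (prod_natCast_add_pow_pos hx k m.2.2)).le
  have h1 : ∀ m : {m : Fin (r + 1) → ℕ // StrictMono m ∧ ∀ i, 0 < m i},
      t ^ ((m.1 (Fin.last r) : ℝ) + x) / ∏ i, ((m.1 i : ℝ) + x) ^ (k i : ℕ)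
        = t ^ x * (t ^ (m.1 (Fin.last r)) * (1 / ∏ i, ((m.1 i : ℝ) + x) ^ (k i : ℕ))) := by
    intro m
    rw [Real.rpow_add ht0, Real.rpow_natCast]
    ring
  simp only [hurwitzLi, h1]
  rw [tsum_mul_left]
  congr 1
  rw [integral_eq_lintegral_of_nonneg_ae (ae_of_all _ fun v => zetaTrunc_nonneg hx k _)
    (measurable_comp_floor _ _).aestronglyMeasurable]
  simp only [← tsum_ite_last_le_eq_zetaTrunc hx k]
  rw [lintegral_tsum]
  · have h2 : ∀ m : {m : Fin (r + 1) → ℕ // StrictMono m ∧ ∀ i, 0 < m i}, _ := fun m =>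
      lintegral_ite_le_floor hs (hpos m) (m.2.2 (Fin.last r))
    simp only [h2, hexp]
    rw [ENNReal.tsum_toReal_eq fun m => ENNReal.ofReal_ne_top]
    refine tsum_congr fun m => ?_
    rw [ENNReal.toReal_ofReal (mul_nonneg (by positivity) (hpos m))]
  · intro m
    refine Measurable.aemeasurable ?_
    exact (measurable_from_nat (f := fun n => if m.1 (Fin.last r) ≤ n then
        ENNReal.ofReal (1 / ∏ i, ((m.1 i : ℝ) + x) ^ (k i : ℕ)) else 0)).comp
      (Nat.measurable_floor.comp (measurable_id.div_const _))

/-! ### Averaging the expansion over the exponential law -/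

/-- An asymptotic expansion in `log N` along the integers extends to positive reals. -/
theorem exists_abs_floor_sub_le {F : ℕ → ℝ} {W : ℝ[X]} {C : ℝ} {p : ℕ} (hC : 0 ≤ C)
    (hF : ∀ N : ℕ, 1 ≤ N → |F N - W.eval (Real.log N)| ≤ C * (1 + Real.log N) ^ p / N) :
    ∃ (D : ℝ) (q : ℕ), 0 ≤ D ∧ ∀ u : ℝ, 0 < u →
      |F (⌊u⌋₊ + 1) - W.eval (Real.log u)| ≤ D * ((1 + |Real.log u|) ^ q * min 1 u⁻¹) := by
  obtain ⟨E, a, hE, hW⟩ := exists_abs_eval_le W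
  obtain ⟨T, b, hT, hL⟩ := exists_abs_eval_sub_le W
  -- `|F 1| + E` serves `u < 1`, where the floor is `0`; `C * 2 ^ p + T` serves `u ≥ 1`.
  refine ⟨|F 1| + E + C * 2 ^ p + T, p + a + b, by positivity, fun u hu => ?_⟩
  have h1 : (1 : ℝ) ≤ 1 + |Real.log u| := by linarith [abs_nonneg (Real.log u)]
  have hp : (1 + |Real.log u|) ^ p ≤ (1 + |Real.log u|) ^ (p + a + b) :=
    pow_le_pow_right₀ h1 (by omega)
  have ha : (1 + |Real.log u|) ^ a ≤ (1 + |Real.log u|) ^ (p + a + b) :=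
    pow_le_pow_right₀ h1 (by omega)
  have hb : (1 + |Real.log u|) ^ b ≤ (1 + |Real.log u|) ^ (p + a + b) :=
    pow_le_pow_right₀ h1 (by omega)
  have hone : 1 ≤ (1 + |Real.log u|) ^ (p + a + b) := one_le_pow₀ h1
  set X := (1 + |Real.log u|) ^ (p + a + b)
  have hX0 : 0 ≤ X := by linarith
  rcases lt_or_ge u 1 with hu1 | hu1
  · rw [min_eq_left ((one_le_inv₀ hu).2 hu1.le), Nat.floor_eq_zero.2 hu1, zero_add, mul_one]
    calc |F 1 - W.eval (Real.log u)| ≤ |F 1| + E * (1 + |Real.log u|) ^ a :=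
          (abs_sub _ _).trans (add_le_add_right (hW _) _)
      _ ≤ |F 1| * X + E * X := by
          gcongr
          exact le_mul_of_one_le_right (abs_nonneg _) hone
      _ ≤ |F 1| * X + E * X + (C * 2 ^ p * X + T * X) := le_add_of_nonneg_right (by positivity)
      _ = _ := by ring
  · rw [min_eq_right (inv_le_one_of_one_le₀ hu1)]
    have hlog : 0 ≤ Real.log u := Real.log_nonneg hu1
    set N := ⌊u⌋₊ + 1 with hN
    have hN1 : u < N := by rw [hN]; push_cast; exact Nat.lt_floor_add_one u
    have hN2 : (N : ℝ) ≤ u + 1 := by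
      rw [hN]; push_cast; linarith [Nat.floor_le hu.le]
    have hN0 : (0 : ℝ) < N := hu.trans hN1
    have hd0 : 0 ≤ Real.log N - Real.log u := sub_nonneg.2 (Real.log_le_log hu hN1.le)
    have hd : Real.log N - Real.log u ≤ u⁻¹ := by
      rw [← Real.log_div hN0.ne' hu.ne']
      refine (Real.log_le_sub_one_of_pos (by positivity)).trans ?_
      rw [div_sub_one hu.ne', inv_eq_one_div]
      gcongr
      linarith
    have hd1 : u⁻¹ ≤ 1 := inv_le_one_of_one_le₀ hu1
    have e1 := hF N (by omega)
    have e2 := hL (Real.log u) (Real.log N - Real.log u) (by rw [abs_of_nonneg hd0]; linarith)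
    rw [add_sub_cancel, abs_of_nonneg hd0] at e2
    have e3 : C * (1 + Real.log N) ^ p / N ≤ C * 2 ^ p * X * u⁻¹ := by
      have : 0 ≤ Real.log N := by linarith
      calc C * (1 + Real.log N) ^ p / N ≤ C * (2 * (1 + |Real.log u|)) ^ p / u := by
            gcongr
            rw [abs_of_nonneg hlog]; linarith
        _ = C * 2 ^ p * (1 + |Real.log u|) ^ p * u⁻¹ := by rw [mul_pow]; ring
        _ ≤ _ := by gcongr
    calc _ ≤ _ := abs_sub_le _ (W.eval (Real.log N)) _
      _ ≤ C * 2 ^ p * X * u⁻¹ + T * X * u⁻¹ :=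
        add_le_add (e1.trans e3) (e2.trans (by gcongr))
      _ ≤ C * 2 ^ p * X * u⁻¹ + T * X * u⁻¹ + (|F 1| * X * u⁻¹ + E * X * u⁻¹) :=
        le_add_of_nonneg_right (by positivity)
      _ = _ := by ring

/-- A power of the logarithm is traded for `u^δ + u^(-δ)` at cost `δ^(-p)`, and `min 1 u⁻¹ ≤
u^(2δ-1)`. The exponent `2δ - 1` keeps both products above `-1`, hence integrable at `0`. -/
theorem log_pow_mul_min_le {p : ℕ} {δ u : ℝ} (hδ : 0 < δ) (hδ2 : δ ≤ 1 / 2) (hu : 0 < u) :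
    (1 + |Real.log u|) ^ p * min 1 u⁻¹
      ≤ p.factorial * Real.exp 1 * δ⁻¹ ^ p * (u ^ (3 * δ - 1) + u ^ (δ - 1)) := by
  have h1 : (1 + |Real.log u|) ^ p
      ≤ p.factorial * Real.exp 1 * δ⁻¹ ^ p * (u ^ δ + u ^ (-δ)) := by
    have h2 := Real.pow_div_factorial_le_exp (δ * (1 + |Real.log u|)) (by positivity) p
    have h3 : Real.exp (δ * (1 + |Real.log u|)) ≤ Real.exp 1 * (u ^ δ + u ^ (-δ)) := by
      rw [mul_add, Real.exp_add]
      gcongr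
      · linarith
      · rw [Real.rpow_def_of_pos hu, Real.rpow_def_of_pos hu]
        rcases abs_cases (Real.log u) with h | h <;> rw [h.1]
        · rw [mul_comm]; linarith [Real.exp_pos (Real.log u * -δ)]
        · rw [show δ * -Real.log u = Real.log u * -δ by ring]
          linarith [Real.exp_pos (Real.log u * δ)]
    have h4 := (div_le_iff₀ (by positivity)).1 (h2.trans h3)
    rw [mul_pow] at h4
    calc (1 + |Real.log u|) ^ p = δ⁻¹ ^ p * (δ ^ p * (1 + |Real.log u|) ^ p) := by
          rw [← mul_assoc, ← mul_pow, inv_mul_cancel₀ hδ.ne', one_pow, one_mul]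
      _ ≤ δ⁻¹ ^ p * (Real.exp 1 * (u ^ δ + u ^ (-δ)) * p.factorial) := by gcongr
      _ = _ := by ring
  have h2 : min 1 u⁻¹ ≤ u ^ (2 * δ - 1) := by
    rcases le_total u 1 with h | h
    · exact (min_le_left _ _).trans (Real.one_le_rpow_of_pos_of_le_one_of_nonpos hu h (by linarith))
    · refine (min_le_right _ _).trans ?_
      rw [← Real.rpow_neg_one]
      exact Real.rpow_le_rpow_of_exponent_le h (by linarith)
  calc _ ≤ (p.factorial * Real.exp 1 * δ⁻¹ ^ p * (u ^ δ + u ^ (-δ))) * u ^ (2 * δ - 1) := by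
        gcongr
    _ = p.factorial * Real.exp 1 * δ⁻¹ ^ p
        * (u ^ δ * u ^ (2 * δ - 1) + u ^ (-δ) * u ^ (2 * δ - 1)) := by ring
    _ = _ := by
      rw [← Real.rpow_add hu, ← Real.rpow_add hu]
      congr 3 <;> ring_nf

/-- `Γ(y) = Γ(y+1)/y`, and `Γ` is bounded on `[1, 5/2]`. The range covers `y = 3δ` with `δ ≤ 1/2`.
-/
theorem exists_Gamma_le : ∃ K : ℝ, 0 < K ∧ ∀ y : ℝ, 0 < y → y ≤ 3 / 2 → Real.Gamma y ≤ K / y := by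
  have hc : ContinuousOn Real.Gamma (Icc 1 (5 / 2)) := fun y hy =>
    (Real.differentiableAt_Gamma fun m h => by
      linarith [hy.1, (Nat.cast_nonneg m : (0 : ℝ) ≤ m)]).continuousAt.continuousWithinAt
  obtain ⟨K, hK⟩ := isCompact_Icc.exists_bound_of_continuousOn hc
  refine ⟨|K| + 1, by positivity, fun y hy hy' => ?_⟩
  rw [le_div_iff₀ hy, mul_comm, ← Real.Gamma_add_one hy.ne']
  have := hK (y + 1) ⟨by linarith, by linarith⟩
  exact (le_abs_self _).trans (this.trans ((le_abs_self K).trans (by linarith)))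

theorem integral_rpow_scaled_le {K : ℝ}
    (hΓ : ∀ y : ℝ, 0 < y → y ≤ 3 / 2 → Real.Gamma y ≤ K / y) {s y : ℝ} (hs : 0 < s)
    (hy : 0 < y) (hy' : y ≤ 3 / 2) :
    Integrable (fun v : ℝ => s ^ (1 - y) * v ^ (y - 1)) expLaw ∧
    ∫ v : ℝ, s ^ (1 - y) * v ^ (y - 1) ∂expLaw ≤ K * s * Real.exp (y * -Real.log s) / y := by
  refine ⟨(integrable_rpow_expLaw (by linarith)).const_mul _, ?_⟩
  rw [integral_const_mul, integral_rpow_expLaw (by linarith), add_sub_cancel]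
  have e : s ^ (1 - y) = s * Real.exp (y * -Real.log s) := by
    rw [sub_eq_add_neg, Real.rpow_add hs, Real.rpow_one, Real.rpow_def_of_pos hs]
    congr 2; ring
  rw [e]
  calc _ ≤ s * Real.exp (y * -Real.log s) * (K / y) := by
        gcongr
        exact hΓ y hy hy'
    _ = _ := by ring

theorem exists_integral_log_pow_mul_min_le (p : ℕ) : ∃ K : ℝ, 0 ≤ K ∧ ∀ s : ℝ, 0 < s → s < 1 →
    ∃ G : ℝ → ℝ, Integrable G expLaw ∧
      (∀ v, 0 < v → (1 + |Real.log (v / s)|) ^ p * min 1 (v / s)⁻¹ ≤ G v) ∧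
      ∫ v, G v ∂expLaw ≤ K * s * (2 - Real.log s) ^ (p + 1) := by
  obtain ⟨K, hK, hΓ⟩ := exists_Gamma_le
  refine ⟨p.factorial * Real.exp 1 * (2 * (K * Real.exp 3)), by positivity, fun s hs hs1 => ?_⟩
  have hlog : 0 < -Real.log s := by linarith [Real.log_neg hs hs1]
  -- With this `δ`, `s^(-δ) ≤ e` and `s^(-3δ) ≤ e³`, while `δ⁻¹` is only logarithmic in `s`. It
  -- enters `p` times from the trade of logarithms for powers and once from the pole of `Γ`.
  set δ : ℝ := (2 - Real.log s)⁻¹ with hδ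
  have hden : 0 < 2 - Real.log s := by linarith
  have hδ0 : 0 < δ := by positivity
  have hδ2 : δ ≤ 1 / 2 := by
    rw [hδ, one_div]; exact inv_anti₀ (by norm_num) (by linarith)
  have hδL : δ * -Real.log s ≤ 1 := by
    rw [hδ, inv_mul_le_iff₀ hden]; linarith
  obtain ⟨hi1, hb1⟩ := integral_rpow_scaled_le hΓ hs (y := 3 * δ) (by linarith) (by linarith)
  obtain ⟨hi2, hb2⟩ := integral_rpow_scaled_le hΓ hs (y := δ) (by linarith) (by linarith)
  refine ⟨fun v => p.factorial * Real.exp 1 * δ⁻¹ ^ p *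
    (s ^ (1 - 3 * δ) * v ^ (3 * δ - 1) + s ^ (1 - δ) * v ^ (δ - 1)),
    (hi1.add hi2).const_mul _, fun v hv => ?_, ?_⟩
  · refine (log_pow_mul_min_le hδ0 hδ2 (div_pos hv hs)).trans (le_of_eq ?_)
    congr 1
    rw [Real.div_rpow hv.le hs.le, Real.div_rpow hv.le hs.le, div_eq_mul_inv, div_eq_mul_inv,
      ← Real.rpow_neg hs.le, ← Real.rpow_neg hs.le, neg_sub, neg_sub, mul_comm, add_comm,
      mul_comm (v ^ (δ - 1)), add_comm]
  · rw [integral_const_mul, integral_add hi1 hi2]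
    have hb1' : ∫ v : ℝ, s ^ (1 - 3 * δ) * v ^ (3 * δ - 1) ∂expLaw ≤ K * Real.exp 3 * s * δ⁻¹ := by
      refine hb1.trans ?_
      calc K * s * Real.exp (3 * δ * -Real.log s) / (3 * δ) ≤ K * s * Real.exp 3 / δ := by
            gcongr <;> linarith
        _ = _ := by ring
    have hb2' : ∫ v : ℝ, s ^ (1 - δ) * v ^ (δ - 1) ∂expLaw ≤ K * Real.exp 3 * s * δ⁻¹ := by
      refine hb2.trans ?_
      calc K * s * Real.exp (δ * -Real.log s) / δ ≤ K * s * Real.exp 3 / δ := by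
            gcongr; linarith
        _ = _ := by ring
    calc _ ≤ p.factorial * Real.exp 1 * δ⁻¹ ^ p *
          (K * Real.exp 3 * s * δ⁻¹ + K * Real.exp 3 * s * δ⁻¹) := by gcongr
      _ = _ := by rw [hδ, inv_inv]; ring

/-- Laplace transform of an asymptotic expansion in `log N`. -/
theorem exists_abs_integral_floor_sub_le {F : ℕ → ℝ} {W : ℝ[X]} {C : ℝ} {p : ℕ} (hC : 0 ≤ C)
    (hF : ∀ N : ℕ, 1 ≤ N → |F N - W.eval (Real.log N)| ≤ C * (1 + Real.log N) ^ p / N) :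
    ∃ (D : ℝ) (q : ℕ), 0 ≤ D ∧ ∀ s : ℝ, 0 < s → s < 1 →
      |∫ v, F (⌊v / s⌋₊ + 1) ∂expLaw
        - (rho (W.comp (X - Polynomial.C Real.eulerMascheroniConstant))).eval (-Real.log s)|
        ≤ D * s * (2 - Real.log s) ^ q := by
  obtain ⟨D, q, hD, h⟩ := exists_abs_floor_sub_le hC hF
  obtain ⟨K, hK, hG⟩ := exists_integral_log_pow_mul_min_le q
  refine ⟨D * K, q + 1, by positivity, fun s hs hs1 => ?_⟩
  obtain ⟨G, hGi, hGb, hGint⟩ := hG s hs hs1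
  -- The shift by `-γ` cancels the `γ` in `shiftedLog`, so `V` at `-log s + shiftedLog v` is
  -- `W(log(v/s))`.
  set V := W.comp (X - Polynomial.C Real.eulerMascheroniConstant) with hV
  have hVi := integrable_eval_add_shiftedLog V (-Real.log s)
  have hbound : ∀ᵐ v ∂expLaw, ‖F (⌊v / s⌋₊ + 1) - V.eval (-Real.log s + shiftedLog v)‖
      ≤ D * G v := by
    filter_upwards [ae_pos_expLaw] with v hv
    have e : V.eval (-Real.log s + shiftedLog v) = W.eval (Real.log (v / s)) := by
      rw [hV, eval_comp, Real.log_div hv.ne' hs.ne', shiftedLog]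
      simp only [eval_sub, eval_X, eval_C]
      congr 1; ring
    rw [e, Real.norm_eq_abs]
    exact (h _ (div_pos hv hs)).trans (mul_le_mul_of_nonneg_left (hGb v hv) hD)
  have hdi : Integrable (fun v => F (⌊v / s⌋₊ + 1) - V.eval (-Real.log s + shiftedLog v)) expLaw :=
    (hGi.const_mul D).mono'
      ((measurable_comp_floor F s).aestronglyMeasurable.sub hVi.aestronglyMeasurable) hbound
  have hFi : Integrable (fun v => F (⌊v / s⌋₊ + 1)) expLaw := by
    refine (hdi.add hVi).congr (ae_of_all _ fun v => ?_)
    simp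
  rw [eval_rho, ← integral_sub hFi hVi, ← Real.norm_eq_abs]
  refine (norm_integral_le_of_norm_le (hGi.const_mul D) hbound).trans ?_
  rw [integral_const_mul]
  calc _ ≤ D * (K * s * (2 - Real.log s) ^ (q + 1)) := by gcongr
    _ = _ := by ring

/-! ### Uniqueness of the polynomials -/

theorem eq_zero_of_tendsto_eval {α : Type*} {l : Filter α} [l.NeBot] {f : α → ℝ} {Q : ℝ[X]}
    (hf : Tendsto f l atTop) (hQ : Tendsto (fun a => Q.eval (f a)) l (𝓝 0)) : Q = 0 := by
  by_cases hdeg : 0 < Q.degree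
  · exact absurd hQ.abs (not_tendsto_nhds_of_tendsto_atTop ((Q.abs_tendsto_atTop hdeg).comp hf) _)
  · obtain ⟨c, rfl⟩ : ∃ c, Q = Polynomial.C c := ⟨_, eq_C_of_degree_le_zero (not_lt.1 hdeg)⟩
    simp only [eval_C] at hQ
    rw [tendsto_nhds_unique tendsto_const_nhds hQ, map_zero]

theorem eq_of_isBigO_sub_eval {α : Type*} {l : Filter α} [l.NeBot] {f F g h : α → ℝ} {P Q : ℝ[X]}
    (hf : Tendsto f l atTop) (hP : (fun a => F a - P.eval (f a)) =O[l] g)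
    (hQ : (fun a => F a - Q.eval (f a)) =O[l] h) (hg : Tendsto g l (𝓝 0))
    (hh : Tendsto h l (𝓝 0)) : P = Q := by
  rw [← sub_eq_zero]
  refine eq_zero_of_tendsto_eval hf ?_
  have := (hQ.trans_tendsto hh).sub (hP.trans_tendsto hg)
  simpa using this

theorem tendsto_inv_mul_log_pow (p : ℕ) :
    Tendsto (fun y : ℝ => y⁻¹ * Real.log y ^ p) atTop (𝓝 0) := by
  refine (Real.isLittleO_pow_log_id_atTop (n := p)).tendsto_div_nhds_zero.congr fun y => ?_
  rw [id, div_eq_inv_mul]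

theorem tendsto_one_sub_nhdsLT_one : Tendsto (fun t : ℝ => 1 - t) (𝓝[<] 1) (𝓝[>] 0) := by
  refine tendsto_nhdsWithin_iff.2 ⟨?_, ?_⟩
  · have h : Tendsto (fun t : ℝ => 1 - t) (𝓝 1) (𝓝 (1 - 1)) :=
      (continuous_const.sub continuous_id).tendsto 1
    rw [sub_self] at h
    exact h.mono_left nhdsWithin_le_nhds
  · filter_upwards [self_mem_nhdsWithin] with t ht
    exact sub_pos.2 (mem_Iio.1 ht)

theorem tendsto_one_sub_mul_log_pow (p : ℕ) :
    Tendsto (fun t : ℝ => (1 - t) * Real.log (1 - t) ^ p) (𝓝[<] 1) (𝓝 0) := by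
  have h := (((tendsto_inv_mul_log_pow p).comp tendsto_inv_nhdsGT_zero).comp
    tendsto_one_sub_nhdsLT_one).const_mul ((-1) ^ p)
  rw [mul_zero] at h
  refine h.congr fun t => ?_
  simp only [Function.comp, inv_inv, Real.log_inv]
  rw [mul_left_comm, ← mul_pow, neg_one_mul, neg_neg]

theorem tendsto_neg_log_one_sub :
    Tendsto (fun t : ℝ => -Real.log (1 - t)) (𝓝[<] 1) atTop :=
  tendsto_neg_atBot_atTop.comp (Real.tendsto_log_nhdsGT_zero.comp tendsto_one_sub_nhdsLT_one)

theorem IsSeriesReg.unique {x : ℝ} {r : ℕ} {k : Fin r → ℕ+} {Z Z' : ℝ[X]}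
    (h : IsSeriesReg x k Z) (h' : IsSeriesReg x k Z') : Z = Z' := by
  obtain ⟨p, -, h⟩ := h
  obtain ⟨q, -, h'⟩ := h'
  exact eq_of_isBigO_sub_eval (tendsto_atTop_add_const_right _ _
    (Real.tendsto_log_atTop.comp tendsto_natCast_atTop_atTop)) h h'
    ((tendsto_inv_mul_log_pow p).comp tendsto_natCast_atTop_atTop)
    ((tendsto_inv_mul_log_pow q).comp tendsto_natCast_atTop_atTop)

theorem IsIntegralReg.unique {x : ℝ} {r : ℕ} {k : Fin r → ℕ+} {P P' : ℝ[X]}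
    (h : IsIntegralReg x k P) (h' : IsIntegralReg x k P') : P = P' := by
  obtain ⟨p, -, h⟩ := h
  obtain ⟨q, -, h'⟩ := h'
  exact eq_of_isBigO_sub_eval tendsto_neg_log_one_sub h h' (tendsto_one_sub_mul_log_pow p)
    (tendsto_one_sub_mul_log_pow q)

/-! ### Existence of both regularizations -/

theorem isSeriesReg_comp {x : ℝ} {r : ℕ} {k : Fin r → ℕ+} {W : ℝ[X]} {C : ℝ} {p : ℕ} (hC : 0 ≤ C)
    (h : ∀ N : ℕ, 1 ≤ N →
      |zetaTrunc x k N - W.eval (Real.log N)| ≤ C * (1 + Real.log N) ^ p / N) :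
    IsSeriesReg x k (W.comp (X + Polynomial.C (digamma (1 + x)))) := by
  -- The exponent must be positive, and `p` may be `0`.
  refine ⟨p + 1, by omega, IsBigO.of_bound (C * 2 ^ p) ?_⟩
  filter_upwards [(Real.tendsto_log_atTop.comp tendsto_natCast_atTop_atTop).eventually_ge_atTop 1,
    eventually_ge_atTop 1] with N hlog hN
  simp only [Function.comp] at hlog
  have hN' : (1 : ℝ) ≤ N := by exact_mod_cast hN
  have hL : 0 ≤ Real.log N := by linarith
  rw [eval_comp]
  simp only [eval_add, eval_X, eval_C, sub_add_cancel, Real.norm_eq_abs]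
  rw [abs_of_nonneg (by positivity : 0 ≤ (N : ℝ)⁻¹ * Real.log N ^ (p + 1))]
  calc _ ≤ _ := h N hN
    _ ≤ C * (2 * Real.log N) ^ p / N := by gcongr; linarith
    _ = C * 2 ^ p * ((N : ℝ)⁻¹ * Real.log N ^ p) := by rw [mul_pow]; ring
    _ ≤ _ := by
      gcongr
      omega

/-- Since `|x| < 1`, `t ≤ t^x ≤ t⁻¹`. -/
theorem abs_rpow_sub_one_le {x t : ℝ} (hx : |x| < 1) (ht : 1 / 2 < t) (ht1 : t < 1) :
    |t ^ x - 1| ≤ 2 * (1 - t) := by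
  have ht0 : 0 < t := by linarith
  have h1 : t ≤ t ^ x := by
    simpa using Real.rpow_le_rpow_of_exponent_ge ht0 ht1.le (abs_lt.1 hx).2.le
  have h2 : t ^ x ≤ t⁻¹ := by
    simpa [Real.rpow_neg_one] using Real.rpow_le_rpow_of_exponent_ge ht0 ht1.le (abs_lt.1 hx).1.le
  have h3 : t⁻¹ - 1 ≤ 2 * (1 - t) := by
    rw [sub_le_iff_le_add, inv_le_iff_one_le_mul₀ ht0]
    nlinarith
  rw [abs_le]
  constructor <;> linarith

/-- Change of variable `s = -log t` in an expansion at `s = 0`. -/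
theorem isIntegralReg_of_expansion {x : ℝ} (hx : |x| < 1) {r : ℕ} {k : Fin r → ℕ+} {P : ℝ[X]}
    {I : ℝ → ℝ} {D : ℝ} {q : ℕ} (hD : 0 ≤ D)
    (hI : ∀ t, 0 < t → t < 1 → hurwitzLi x k t = t ^ x * I (-Real.log t))
    (h : ∀ s : ℝ, 0 < s → s < 1 →
      |I s - P.eval (-Real.log s)| ≤ D * s * (2 - Real.log s) ^ q) :
    IsIntegralReg x k P := by
  obtain ⟨E, a, hE, hP⟩ := exists_abs_eval_le P
  obtain ⟨T, b, hT, hL⟩ := exists_abs_eval_sub_le P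
  -- The three constants bound, in order, the error of the expansion in `s`, the replacement of
  -- `t^x` by `1`, and the passage from `-log s` to `-log(1-t)`.
  refine ⟨q + a + b + 1, by omega, IsBigO.of_bound
    (4 * D * 3 ^ q + 2 * E * 2 ^ a + 2 * T * 2 ^ b) ?_⟩
  filter_upwards [tendsto_neg_log_one_sub.eventually_ge_atTop 1,
    mem_nhdsWithin_of_mem_nhds (Ioi_mem_nhds (show (1 / 2 : ℝ) < 1 by norm_num)),
    self_mem_nhdsWithin] with t hlog ht ht1
  simp only [mem_Ioi, mem_Iio] at ht ht1
  have ht0 : 0 < t := by linarith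
  obtain ⟨ε, hε⟩ : ∃ ε, ε = 1 - t := ⟨_, rfl⟩
  obtain ⟨s, hs⟩ : ∃ s, s = -Real.log t := ⟨_, rfl⟩
  rw [hI t ht0 ht1, ← hs, ← hε]
  rw [← hε] at hlog
  have hε0 : 0 < ε := by linarith
  have hsε : ε ≤ s := by linarith [Real.log_le_sub_one_of_pos ht0]
  have hs0 : 0 < s := hε0.trans_le hsε
  have hst : s ≤ ε / t := by
    have h1 := Real.one_sub_inv_le_log_of_pos ht0
    have h2 : ε / t = t⁻¹ - 1 := by rw [hε]; field_simp
    linarith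
  have hs2 : s ≤ 2 * ε := by
    refine hst.trans ?_
    rw [div_le_iff₀ ht0]; nlinarith
  have hs1 : s < 1 := by linarith
  obtain ⟨Λ, hΛ⟩ : ∃ Λ, Λ = -Real.log ε := ⟨_, rfl⟩
  obtain ⟨M, hM⟩ : ∃ M, M = -Real.log s := ⟨_, rfl⟩
  have hM0 : 0 ≤ M := by linarith [Real.log_neg hs0 hs1]
  have hMΛ : M ≤ Λ := by linarith [Real.log_le_log hε0 hsε]
  have hdiff : Λ - M ≤ 2 * ε := by
    have h1 := Real.log_le_log hs0 hst
    rw [Real.log_div hε0.ne' ht0.ne'] at h1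
    linarith
  have hh := h s hs0 hs1
  have hx1 := abs_rpow_sub_one_le hx ht ht1
  rw [← hε] at hx1
  have htx : |t ^ x| ≤ 2 := by
    calc |t ^ x| = |(t ^ x - 1) + 1| := by congr 1; ring
      _ ≤ 2 * ε + |1| := (abs_add_le _ _).trans (add_le_add_left hx1 _)
      _ ≤ 2 := by rw [abs_one]; linarith
  rw [← hM, show 2 - Real.log s = 2 + M by rw [hM]; ring] at hh
  rw [← hΛ] at hlog
  have hnorm : ‖ε * Real.log ε ^ (q + a + b + 1)‖ = ε * Λ ^ (q + a + b + 1) := by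
    rw [norm_mul, norm_pow, Real.norm_eq_abs, Real.norm_eq_abs, abs_of_pos hε0,
      show Real.log ε = -Λ by rw [hΛ]; ring, abs_neg, abs_of_nonneg (by linarith)]
  rw [hnorm, ← hΛ, Real.norm_eq_abs]
  have hΛ0 : 0 ≤ Λ := by linarith
  have e1 : |t ^ x * (I s - P.eval M)| ≤ 4 * D * 3 ^ q * (ε * Λ ^ (q + a + b + 1)) := by
    rw [abs_mul]
    calc _ ≤ 2 * (D * s * (2 + M) ^ q) := by gcongr
      _ ≤ 2 * (D * (2 * ε) * (3 * Λ) ^ q) := by gcongr; linarith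
      _ = 4 * D * 3 ^ q * (ε * Λ ^ q) := by rw [mul_pow]; ring
      _ ≤ _ := by
        gcongr
        omega
  have e2 : |(t ^ x - 1) * P.eval M| ≤ 2 * E * 2 ^ a * (ε * Λ ^ (q + a + b + 1)) := by
    rw [abs_mul]
    have h1 := hP M
    rw [abs_of_nonneg hM0] at h1
    calc _ ≤ 2 * ε * (E * (1 + M) ^ a) := by gcongr
      _ ≤ 2 * ε * (E * (2 * Λ) ^ a) := by gcongr; linarith
      _ = 2 * E * 2 ^ a * (ε * Λ ^ a) := by rw [mul_pow]; ring
      _ ≤ _ := by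
        gcongr
        omega
  have e3 : |P.eval M - P.eval Λ| ≤ 2 * T * 2 ^ b * (ε * Λ ^ (q + a + b + 1)) := by
    have h1 := hL M (Λ - M) (by rw [abs_of_nonneg (by linarith)]; linarith)
    rw [add_sub_cancel, abs_of_nonneg hM0, abs_of_nonneg (sub_nonneg.2 hMΛ)] at h1
    rw [abs_sub_comm]
    calc _ ≤ T * (1 + M) ^ b * (Λ - M) := h1
      _ ≤ T * (2 * Λ) ^ b * (2 * ε) := by
        gcongr
        linarith
      _ = 2 * T * 2 ^ b * (ε * Λ ^ b) := by rw [mul_pow]; ring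
      _ ≤ _ := by
        gcongr
        omega
  calc |t ^ x * I s - P.eval Λ|
      = |t ^ x * (I s - P.eval M) + (t ^ x - 1) * P.eval M + (P.eval M - P.eval Λ)| := by
        congr 1; ring
    _ ≤ _ := (abs_add_three _ _ _).trans (add_le_add (add_le_add e1 e2) e3)
    _ = _ := by ring

theorem rho_one : rho 1 = 1 := by
  have := isProbabilityMeasure_expLaw
  refine Polynomial.funext fun a => ?_
  rw [eval_rho]
  simp

/-- One polynomial in `log N` governs both regularizations. -/
theorem exists_common_reg {x : ℝ} (hx : |x| < 1) {r : ℕ} (k : Fin r → ℕ+) : ∃ W : ℝ[X],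
    IsSeriesReg x k (W.comp (X + Polynomial.C (digamma (1 + x)))) ∧
    IsIntegralReg x k (rho (W.comp (X - Polynomial.C Real.eulerMascheroniConstant))) := by
  rcases r with _ | r
  -- Depth zero is separate: the polylogarithm is then `1` by convention, without the factor `t^x`.
  · refine ⟨1, isSeriesReg_comp (C := 0) (p := 0) le_rfl fun N _ => by simp [zetaTrunc_zero], ?_⟩
    refine ⟨1, one_pos, ?_⟩
    simp only [one_comp, rho_one, eval_one, hurwitzLi, sub_self]
    exact isBigO_zero _ _
  · obtain ⟨W, C, p, hC, h⟩ := exists_zetaTrunc_asymp hx k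
    obtain ⟨D, q, hD, h'⟩ := exists_abs_integral_floor_sub_le hC h
    exact ⟨W, isSeriesReg_comp hC h, isIntegralReg_of_expansion hx hD
      (I := fun s => ∫ v, zetaTrunc x k (⌊v / s⌋₊ + 1) ∂expLaw)
      (fun t ht0 ht1 => hurwitzLi_eq_integral hx k ht0 ht1) h'⟩

end HurwitzMZV

theorem theorem2p2 (x : ℝ) (hx : |x| < 1) {r : ℕ} (k : Fin r → ℕ+) :
    (∃! Z : Polynomial ℝ, HurwitzMZV.IsSeriesReg x k Z) ∧
    (∃! P : Polynomial ℝ, HurwitzMZV.IsIntegralReg x k P) ∧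
    HurwitzMZV.integralRegPoly x k =
      HurwitzMZV.rho ((HurwitzMZV.seriesRegPoly x k).comp
        (Polynomial.X - Polynomial.C Real.eulerMascheroniConstant
          - Polynomial.C (HurwitzMZV.digamma (1 + x)))) := by
  obtain ⟨W, hZ, hP⟩ := HurwitzMZV.exists_common_reg hx k
  refine ⟨⟨_, hZ, fun Z h => h.unique hZ⟩, ⟨_, hP, fun P h => h.unique hP⟩, ?_⟩
  have h1 : HurwitzMZV.integralRegPoly x k = _ :=
    HurwitzMZV.IsIntegralReg.unique (Classical.epsilon_spec ⟨_, hP⟩) hP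
  have h2 : HurwitzMZV.seriesRegPoly x k = _ :=
    HurwitzMZV.IsSeriesReg.unique (Classical.epsilon_spec ⟨_, hZ⟩) hZ
  -- The two shifts by `ψ(1+x)` cancel.
  rw [h1, h2, Polynomial.comp_assoc]
  simp
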